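/- Let $n,b\ge 1$ be integers with $b\mid n$ and put $m=n/b$ (the number of mini-batch iterations per epoch). Let $\eta>0$, let $o(\eta,k,j)\ge 0$ be noise levels ($k\ge 0$, $0\le j<m$), let $r:\mathbb R^d\to\mathbb R$ be convex, and let $f_{k,j}:\mathbb R^d\to\mathbb R$ be differentiable functions (the objective of the layer under consideration on the mini-batch of iteration $j$ of epoch $k$, all other blocks of variables being fixed). Put $F_{k,j}(\theta)=\theta-\eta\nabla f_{k,j}(\theta)$ and $T(\theta)=\mathrm{Prox}_{\eta,r}(\theta)=\arg\min_{p}\{r(p)+\frac1{2\eta}\|p-\theta\|_2^2\}$. Starting from a deterministic $\theta_0^0\in\mathbb R^d$, let $$\theta_k^{j+1}=T\bigl(F_{k,j}(\theta_k^j)+\xi_{k,j}\bigr)\quad(0\le j<m),\qquad \theta_{k+1}^0=\theta_k^{m},$$ with independent noises $\xi_{k,j}\sim\mathcal N(0,2\eta\,o(\eta,k,j)\,I)$. That is, the law of $\theta_k^{j+1}$ is $T_\#\bigl((F_{k,j})_\#\mathrm{Law}(\theta_k^j)*\mathcal N(0,2\eta\,o(\eta,k,j)I)\bigr)$. A probability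 distribution $\nu$ on $\mathbb R^d$ satisfies the log-Sobolev inequality (LSI) with constant $c\in(0,\infty]$ if for every smooth $g:\mathbb R^d\to\mathbb R$ with $\mathbb E_\nu[g^2]<\infty$, $$\mathbb E_\nu[g^2\log g^2]-\mathbb E_\nu[g^2]\log\mathbb E_\nu[g^2]\le\frac2c\,\mathbb E_\nu[\|\nabla g\|_2^2],$$ where there is no condition on $g$ if $\mathbb E_\nu[\|\nabla g\|_2^2]=\infty$, and $2/\infty=0$. Suppose that every $F_{k,j}$ is Lipschitz with constant $L_F$ and $T$ is Lipschitz with constant $L_T$. Then for all $k\ge 0$ and $0\le j\le m$ the distribution of $\theta_k^j$ satisfies the LSI with the constant $$c_k^j=\frac1{2\eta L_T^2}\left(\sum_{k'=0}^{k-1}\sum_{j'=0}^{m-1}o(\eta,k',j')\,(L_FL_T)^{2((k-k')m-j'+j-1)}+\sum_{j'=0}^{j-1}o(\eta,k,j')\,(L_FL_T)^{2(j-j'-1)}\right)^{-1},$$ where $0^0=1$, and $c_k^j=+\infty$ if $L_T=0$ or the sum in parentheses vanishes (as for $k=j=0$). -/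

import Mathlib

open MeasureTheory ProbabilityTheory
open scoped NNReal ENNReal ContDiff

noncomputable section

/-- A probability distribution `ν` on `ℝ^ι` satisfies the log-Sobolev inequality with constant
`c ∈ (0, ∞]`: for all smooth `g` with `E[g²] < ∞`,
`E[g² log g²] - E[g²] log E[g²] ≤ (2 / c) E[‖∇g‖²]`.
If `E[‖∇g‖²] = ∞` there is nothing to show; if it is finite, then finiteness of the expectation
`E[g² log g²]` (whose integrand is bounded below) is part of the claim.
For `c = ∞` the factor `2 / c` is `0`. -/
def SatisfiesLSI {ι : Type*} [Fintype ι] (ν : Measure (EuclideanSpace ℝ ι)) (c : ℝ≥0∞) : Prop :=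
  IsProbabilityMeasure ν ∧ 0 < c ∧
    ∀ g : EuclideanSpace ℝ ι → ℝ, ContDiff ℝ ∞ g →
      Integrable (fun θ => g θ ^ 2) ν →
      Integrable (fun θ => ‖gradient g θ‖ ^ 2) ν →
      Integrable (fun θ => g θ ^ 2 * Real.log (g θ ^ 2)) ν ∧
        (∫ θ, g θ ^ 2 * Real.log (g θ ^ 2) ∂ν)
            - (∫ θ, g θ ^ 2 ∂ν) * Real.log (∫ θ, g θ ^ 2 ∂ν)
          ≤ (2 / c).toReal * ∫ θ, ‖gradient g θ‖ ^ 2 ∂ν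

/-- The gradient descent map `F(θ) = θ - η ∇f(θ)`. -/
def gradStep {ι : Type*} [Fintype ι] (η : ℝ) (f : EuclideanSpace ℝ ι → ℝ)
    (θ : EuclideanSpace ℝ ι) : EuclideanSpace ℝ ι :=
  θ - η • gradient f θ

/-- The proximal operator `Prox_{η,r}(θ) = argmin_p { r(p) + ‖p - θ‖² / (2η) }`
(for `η > 0` and `r` convex, the minimizer exists and is unique). -/
def prox {ι : Type*} [Fintype ι] (η : ℝ) (r : EuclideanSpace ℝ ι → ℝ)
    (θ : EuclideanSpace ℝ ι) : EuclideanSpace ℝ ι :=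
  Classical.epsilon fun p =>
    ∀ q, r p + 1 / (2 * η) * ‖p - θ‖ ^ 2 ≤ r q + 1 / (2 * η) * ‖q - θ‖ ^ 2

/-- The law of `Prox_{η,r}(θ - η ∇f(θ) + N(0, 2 η s I))`, with independent noise, when `θ` has
law `μ`: the law `T_#(F_# μ * N(0, 2 η s I))`. -/
def noisyProxStep {ι : Type*} [Fintype ι] [DecidableEq ι] (η s : ℝ)
    (f r : EuclideanSpace ℝ ι → ℝ) (μ : Measure (EuclideanSpace ℝ ι)) :
    Measure (EuclideanSpace ℝ ι) :=
  (Measure.conv (μ.map (gradStep η f))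
    (multivariateGaussian 0 ((2 * η * s) • (1 : Matrix ι ι ℝ)))).map (prox η r)

/-- The law of the parameter after the first `j` iterations of epoch `k`, when the epoch starts
from a parameter of law `μ`. Iteration `j` of epoch `k` uses the objective `f k j` and the noise
level `o η k j`. -/
def epochLaw {ι : Type*} [Fintype ι] [DecidableEq ι] (η : ℝ) (o : ℝ → ℕ → ℕ → ℝ)
    (f : ℕ → ℕ → EuclideanSpace ℝ ι → ℝ) (r : EuclideanSpace ℝ ι → ℝ) (k : ℕ)
    (μ : Measure (EuclideanSpace ℝ ι)) : ℕ → Measure (EuclideanSpace ℝ ι)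
  | 0 => μ
  | j + 1 => noisyProxStep η (o η k j) (f k j) r (epochLaw η o f r k μ j)

/-- The law of the parameter at the start of an epoch, with `m` iterations per epoch and
(deterministic) initial parameter `θ₀`. -/
def startLaw {ι : Type*} [Fintype ι] [DecidableEq ι] (η : ℝ) (o : ℝ → ℕ → ℕ → ℝ)
    (f : ℕ → ℕ → EuclideanSpace ℝ ι → ℝ) (r : EuclideanSpace ℝ ι → ℝ) (m : ℕ)
    (θ₀ : EuclideanSpace ℝ ι) : ℕ → Measure (EuclideanSpace ℝ ι)
  | 0 => Measure.dirac θ₀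
  | k + 1 => epochLaw η o f r k (startLaw η o f r m θ₀ k) m

/-- The law of the layer parameter `θ_k^j`, the value entering iteration `j` of epoch `k`
(for `j = m`: the value at the end of epoch `k`). -/
def paramLaw {ι : Type*} [Fintype ι] [DecidableEq ι] (η : ℝ) (o : ℝ → ℕ → ℕ → ℝ)
    (f : ℕ → ℕ → EuclideanSpace ℝ ι → ℝ) (r : EuclideanSpace ℝ ι → ℝ) (m : ℕ)
    (θ₀ : EuclideanSpace ℝ ι) (k j : ℕ) : Measure (EuclideanSpace ℝ ι) :=
  epochLaw η o f r k (startLaw η o f r m θ₀ k) j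

/-- The constant `c_k^j` with `m` iterations per epoch, as an element of `[0, ∞]`: it is `∞` exactly
when `L_T = 0` or the weighted sum of noise levels vanishes (as for `k = j = 0`). No subtraction in
the exponents truncates for `k' < k`, `j' < m`, respectively for `j' < j`. -/
def lsiConst (η : ℝ) (o : ℝ → ℕ → ℕ → ℝ) (LF LT : ℝ≥0) (m k j : ℕ) : ℝ≥0∞ :=
  1 / (2 * ENNReal.ofReal η * (LT : ℝ≥0∞) ^ 2) *
    ((∑ k' ∈ Finset.range k, ∑ j' ∈ Finset.range m,
        ENNReal.ofReal (o η k' j') *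
          ((LF : ℝ≥0∞) * (LT : ℝ≥0∞)) ^ (2 * ((k - k') * m - j' + j - 1)))
      + ∑ j' ∈ Finset.range j,
        ENNReal.ofReal (o η k j') *
          ((LF : ℝ≥0∞) * (LT : ℝ≥0∞)) ^ (2 * (j - j' - 1)))⁻¹

end

/-! The log-Sobolev inequality is not propagated along the iteration: composing a test function with
the nonsmooth map `prox η r` destroys smoothness. What is propagated is a derivative-free
inequality, `HasPrekopaLeindler` for the cost ‖x - z‖² / C, which passes to the log-Sobolev
inequality with constant 1 / C only at the end.

The inequality is Prékopa-Leindler relative to ν with one of the two functions equal to 1 and the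
second point eliminated, so that only x and z = t x + (1 - t) y remain. For Gaussian densities,
completing the square produces exactly the factor exp(-t |x - z|² / (2 (1 - t))). The
one-dimensional case therefore follows from Prékopa-Leindler on the line, and higher dimensions by
tensorization. A Dirac mass has C = 0, an L-Lipschitz image turns C into L² C
(`HasPrekopaLeindler.map_lipschitz`), and convolution adds the constants
(`HasPrekopaLeindler.conv`). One iteration thus sends C to L_T² (L_F² C + 2 η o);
`noiseSum_succ_right` and `noiseSum_epoch_end` solve this recursion.

To recover the log-Sobolev inequality, take t = 1 - s and u = exp(f / (1 - s)), and let s → 0. The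
left side produces the entropy of exp f, while the sup-convolution of f exceeds f by about s C ‖∇f‖²
/ 2. Choosing exp f to be a regularized g² and removing the regularization gives
`HasPrekopaLeindler.logSobolev`. -/

/-! ### Brunn-Minkowski and Prékopa-Leindler on the real line. -/

open scoped Pointwise in
/-- The Brunn-Minkowski inequality on the real line, for compact sets. -/
theorem volume_add_le_volume_add_of_isCompact {A B : Set ℝ} (hA : IsCompact A) (hB : IsCompact B)
    (hA0 : A.Nonempty) (hB0 : B.Nonempty) : volume A + volume B ≤ volume (A + B) := by
  obtain ⟨a, ha, hamax⟩ := hA.exists_isGreatest hA0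
  obtain ⟨b, hb, hbmin⟩ := hB.exists_isLeast hB0
  -- With a = max A and b = min B, the two translates lie in A + B on either side of a + b, so they
  -- overlap in a null set.
  have hinter : (A + {b}) ∩ ({a} + B) ⊆ {a + b} := by
    rintro x ⟨⟨a', ha', b', hb', rfl⟩, ⟨a'', ha'', b'', hb'', h⟩⟩
    simp only [Set.mem_singleton_iff] at hb' ha'' ⊢
    subst hb' ha''
    have h1 := hamax ha'
    have h2 := hbmin hb''
    simp only at h ⊢
    linarith
  have h0 : volume ((A + {b}) ∩ ({a} + B)) = 0 :=
    measure_mono_null hinter (by simp)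
  have hm : MeasurableSet ({a} + B) := (isCompact_singleton.add hB).measurableSet
  calc volume A + volume B = volume (A + {b}) + volume ({a} + B) := by
        simp [Set.singleton_add]
    _ = volume ((A + {b}) ∪ ({a} + B)) := by
        rw [← measure_union_add_inter _ hm, h0, add_zero]
    _ ≤ volume (A + B) := by
        apply measure_mono
        rw [Set.union_subset_iff]
        exact ⟨Set.add_subset_add_left (by simpa using hb),
          Set.add_subset_add_right (by simpa using ha)⟩

open scoped Pointwise in
/-- The Brunn-Minkowski inequality on the real line. -/
theorem volume_add_le_volume_add {A B : Set ℝ} (hA : MeasurableSet A) (hB : MeasurableSet B)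
    (hA0 : A.Nonempty) (hB0 : B.Nonempty) : volume A + volume B ≤ volume (A + B) := by
  obtain ⟨a, ha⟩ := hA0
  obtain ⟨b, hb⟩ := hB0
  have key : ∀ K ⊆ A, IsCompact K → ∀ L ⊆ B, IsCompact L →
      volume K + volume L ≤ volume (A + B) := by
    intro K hKA hK L hLB hL
    -- Inserting a and b keeps the inner approximations nonempty, as the compact case requires.
    have h := volume_add_le_volume_add_of_isCompact (hK.insert a) (hL.insert b)
      (Set.insert_nonempty _ _) (Set.insert_nonempty _ _)
    calc volume K + volume L ≤ volume (insert a K) + volume (insert b L) :=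
          add_le_add (measure_mono (Set.subset_insert _ _)) (measure_mono (Set.subset_insert _ _))
      _ ≤ _ := h
      _ ≤ volume (A + B) := measure_mono
          (Set.add_subset_add (Set.insert_subset ha hKA) (Set.insert_subset hb hLB))
  rw [hA.measure_eq_iSup_isCompact, hB.measure_eq_iSup_isCompact]
  simp only [iSup_and', iSup_subtype']
  have : Nonempty { K : Set ℝ // K ⊆ A ∧ IsCompact K } := ⟨⟨∅, by simp⟩⟩
  have : Nonempty { K : Set ℝ // K ⊆ B ∧ IsCompact K } := ⟨⟨∅, by simp⟩⟩
  exact ENNReal.iSup_add_iSup_le fun K L => key K K.2.1 K.2.2 L L.2.1 L.2.2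

/-- A Prékopa-Leindler inequality on the real line, for functions with supremum `1`. -/
theorem prekopaLeindler_of_normalized {t : ℝ} (ht0 : 0 < t) (ht1 : t < 1) {f g h : ℝ → ℝ≥0∞}
    (hf : Measurable f) (hg : Measurable g) (hh : Measurable h)
    (hf1 : ∀ x, f x ≤ 1) (hg1 : ∀ x, g x ≤ 1)
    (hfs : ∀ r < 1, ∃ x, r < f x) (hgs : ∀ r < 1, ∃ x, r < g x)
    (H : ∀ x y, f x ^ t * g y ^ (1 - t) ≤ h (t * x + (1 - t) * y)) :
    ENNReal.ofReal t * (∫⁻ x, f x) + ENNReal.ofReal (1 - t) * (∫⁻ x, g x) ≤ ∫⁻ x, h x := by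
  have hs : 0 < 1 - t := by linarith
  have layer : ∀ u : ℝ → ℝ≥0∞, Measurable u → (∀ x, u x ≤ 1) →
      ∫⁻ x, u x = ∫⁻ r in Set.Ioi (0 : ℝ), volume {x | ENNReal.ofReal r < u x} := by
    intro u hu hu1
    have hfin : ∀ x, u x ≠ ⊤ := fun x => ((hu1 x).trans_lt ENNReal.one_lt_top).ne
    calc ∫⁻ x, u x = ∫⁻ x, ENNReal.ofReal (u x).toReal := by
          simp [ENNReal.ofReal_toReal, hfin]
      _ = _ := by
          rw [lintegral_eq_lintegral_meas_lt _ (Filter.Eventually.of_forall fun x => by simp)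
            hu.ennreal_toReal.aemeasurable]
          refine setLIntegral_congr_fun measurableSet_Ioi fun r hr => ?_
          simp only [ENNReal.ofReal_lt_iff_lt_toReal (le_of_lt hr) (hfin _)]
  calc _ = (∫⁻ r in Set.Ioi (0 : ℝ), ENNReal.ofReal t * volume {x | ENNReal.ofReal r < f x})
          + ∫⁻ r in Set.Ioi (0 : ℝ), ENNReal.ofReal (1 - t) * volume {x | ENNReal.ofReal r < g x} := by
        rw [lintegral_const_mul' _ _ ENNReal.ofReal_ne_top,
          lintegral_const_mul' _ _ ENNReal.ofReal_ne_top, layer f hf hf1, layer g hg hg1]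
    _ = ∫⁻ r in Set.Ioi (0 : ℝ), (ENNReal.ofReal t * volume {x | ENNReal.ofReal r < f x} +
          ENNReal.ofReal (1 - t) * volume {x | ENNReal.ofReal r < g x}) := by
        rw [lintegral_add_left]
        refine Measurable.const_mul (Antitone.measurable fun r r' hr => ?_) _
        exact measure_mono fun x hx => (ENNReal.ofReal_le_ofReal hr).trans_lt hx
    -- Superlevel sets satisfy t {f > r} + (1 - t) {g > r} ⊆ {h > r}. For r < 1 both summands are
    -- nonempty because the suprema are 1; levels r ≥ 1 contribute nothing, so h may be cut off at
    -- 1.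
    _ ≤ ∫⁻ r in Set.Ioi (0 : ℝ), volume {x | ENNReal.ofReal r < min (h x) 1} := by
        refine setLIntegral_mono' measurableSet_Ioi fun r _ => ?_
        rcases le_or_gt 1 (ENNReal.ofReal r) with hr | hr
        · have h1 : {x | ENNReal.ofReal r < f x} = ∅ := by
            ext x; simpa using (hf1 x).trans hr
          have h2 : {x | ENNReal.ofReal r < g x} = ∅ := by
            ext x; simpa using (hg1 x).trans hr
          simp [h1, h2]
        · have hA : MeasurableSet {x | ENNReal.ofReal r < f x} := measurableSet_lt measurable_const hf
          have hB : MeasurableSet {x | ENNReal.ofReal r < g x} := measurableSet_lt measurable_const hg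
          have hbm := volume_add_le_volume_add (hA.const_smul₀ t) (hB.const_smul₀ (1 - t))
            (Set.Nonempty.smul_set (hfs _ hr)) (Set.Nonempty.smul_set (hgs _ hr))
          rw [Measure.addHaar_smul, Measure.addHaar_smul] at hbm
          simp only [Module.finrank_self, pow_one, abs_of_pos ht0, abs_of_pos hs] at hbm
          refine hbm.trans (measure_mono ?_)
          rintro _ ⟨_, ⟨x, hx, rfl⟩, _, ⟨y, hy, rfl⟩, rfl⟩
          simp only [Set.mem_ofPred_eq, smul_eq_mul, lt_min_iff] at hx hy ⊢
          refine ⟨lt_of_lt_of_le ?_ (H x y), hr⟩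
          calc ENNReal.ofReal r = ENNReal.ofReal r ^ t * ENNReal.ofReal r ^ (1 - t) := by
                rw [← ENNReal.rpow_add_of_nonneg _ _ ht0.le hs.le]; simp
            _ < _ := ENNReal.mul_lt_mul (ENNReal.rpow_lt_rpow hx ht0) (ENNReal.rpow_lt_rpow hy hs)
    _ = ∫⁻ x, min (h x) 1 := (layer _ (hh.min measurable_const) fun x => min_le_right _ _).symm
    _ ≤ ∫⁻ x, h x := lintegral_mono fun x => min_le_left _ _

theorem ENNReal.geom_mean_le_arith_mean2_weighted {t : ℝ} (ht0 : 0 < t) (ht1 : t < 1)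
    (a b : ℝ≥0∞) :
    a ^ t * b ^ (1 - t) ≤ ENNReal.ofReal t * a + ENNReal.ofReal (1 - t) * b := by
  have hs : 0 < 1 - t := by linarith
  induction a with
  | top => simp [ENNReal.mul_top, ht0]
  | coe a =>
    induction b with
    | top => simp [ENNReal.mul_top, ht1]
    | coe b =>
      have h := NNReal.geom_mean_le_arith_mean2_weighted t.toNNReal (1 - t).toNNReal a b
        (by rw [← Real.toNNReal_add ht0.le hs.le]; simp)
      rw [Real.coe_toNNReal _ ht0.le, Real.coe_toNNReal _ hs.le] at h
      rw [← ENNReal.coe_rpow_of_nonneg _ ht0.le, ← ENNReal.coe_rpow_of_nonneg _ hs.le]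
      simpa [ENNReal.ofReal] using (ENNReal.coe_le_coe.2 h)

/-- The Prékopa-Leindler inequality on the real line, for bounded functions. -/
theorem prekopaLeindler_of_bounded {t : ℝ} (ht0 : 0 < t) (ht1 : t < 1) {f g h : ℝ → ℝ≥0∞}
    (hf : Measurable f) (hg : Measurable g) (hh : Measurable h)
    (hfb : ⨆ x, f x ≠ ⊤) (hgb : ⨆ x, g x ≠ ⊤)
    (H : ∀ x y, f x ^ t * g y ^ (1 - t) ≤ h (t * x + (1 - t) * y)) :
    (∫⁻ x, f x) ^ t * (∫⁻ x, g x) ^ (1 - t) ≤ ∫⁻ x, h x := by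
  have hs : 0 < 1 - t := by linarith
  set F := ⨆ x, f x with hF
  set G := ⨆ x, g x with hG
  rcases eq_or_ne F 0 with hF0 | hF0
  · have : f = 0 := by ext x; exact le_antisymm ((le_iSup f x).trans_eq hF0) bot_le
    simp [this, ENNReal.zero_rpow_of_pos ht0]
  rcases eq_or_ne G 0 with hG0 | hG0
  · have : g = 0 := by ext x; exact le_antisymm ((le_iSup g x).trans_eq hG0) bot_le
    simp [this, ENNReal.zero_rpow_of_pos hs]
  have hFt : F ^ t ≠ 0 := (ENNReal.rpow_pos (pos_iff_ne_zero.2 hF0) hfb).ne'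
  have hGt : G ^ (1 - t) ≠ 0 := (ENNReal.rpow_pos (pos_iff_ne_zero.2 hG0) hgb).ne'
  have hFt' : F ^ t ≠ ⊤ := ENNReal.rpow_ne_top_of_nonneg ht0.le hfb
  have hGt' : G ^ (1 - t) ≠ ⊤ := ENNReal.rpow_ne_top_of_nonneg hs.le hgb
  have sup_div : ∀ (u : ℝ → ℝ≥0∞) (U : ℝ≥0∞), U = ⨆ x, u x → U ≠ 0 → U ≠ ⊤ →
      (∀ x, u x / U ≤ 1) ∧ ∀ r < 1, ∃ x, r < u x / U := by
    intro u U hU hU0 hU1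
    refine ⟨fun x => ENNReal.div_le_of_le_mul (by simpa [hU] using le_iSup u x), fun r hr => ?_⟩
    have : r * U < ⨆ x, u x := by
      rw [← hU]
      simpa using ENNReal.mul_lt_mul_left hU0 hU1 hr
    obtain ⟨x, hx⟩ := lt_iSup_iff.1 this
    exact ⟨x, (ENNReal.lt_div_iff_mul_lt (Or.inl hU0) (Or.inl hU1)).2 hx⟩
  obtain ⟨hf1, hfs⟩ := sup_div f F hF hF0 hfb
  obtain ⟨hg1, hgs⟩ := sup_div g G hG hG0 hgb
  -- Dividing h by F ^ t * G ^ (1 - t) preserves the hypothesis. The normalized case bounds an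
  -- arithmetic mean, and weighted AM-GM then gives the geometric one, which scales back.
  have key := prekopaLeindler_of_normalized ht0 ht1 (f := fun x => f x / F) (g := fun x => g x / G)
    (h := fun x => h x / (F ^ t * G ^ (1 - t))) (hf.div_const _) (hg.div_const _) (hh.div_const _)
    hf1 hg1 hfs hgs (fun x y => by
      rw [ENNReal.div_rpow_of_nonneg _ _ ht0.le, ENNReal.div_rpow_of_nonneg _ _ hs.le]
      rw [← ENNReal.mul_div_mul_comm (Or.inl hFt) (Or.inr hGt)]
      exact ENNReal.div_le_div_right (H x y) _)
  have key2 := (ENNReal.geom_mean_le_arith_mean2_weighted ht0 ht1 _ _).trans key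
  simp only [div_eq_mul_inv] at key2
  rw [lintegral_mul_const _ hf, lintegral_mul_const _ hg, lintegral_mul_const _ hh] at key2
  simp only [← div_eq_mul_inv] at key2
  rw [ENNReal.div_rpow_of_nonneg _ _ ht0.le, ENNReal.div_rpow_of_nonneg _ _ hs.le,
    ← ENNReal.mul_div_mul_comm (Or.inl hFt) (Or.inr hGt)] at key2
  have h3 := ENNReal.mul_le_of_le_div key2
  rwa [ENNReal.div_mul_cancel (mul_ne_zero hFt hGt) (ENNReal.mul_ne_top hFt' hGt')] at h3

/-! ### The transport-cost inequality: images, products and the standard Gaussian. -/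

/-- A Prékopa-Leindler inequality for a measure `ν` with respect to a transport cost, where
`R x z a` says that `a` is an admissible cost for moving `x` to `z`. The standard Gaussian has it
for the squared distance. -/
def HasPrekopaLeindler {α : Type*} [MeasurableSpace α] (ν : Measure α)
    (R : α → α → ℝ → Prop) : Prop :=
  ∀ t : ℝ, 0 < t → t < 1 → ∀ u w : α → ℝ≥0∞, Measurable u → Measurable w →
    (∀ x z a, R x z a → u x ^ t * ENNReal.ofReal (Real.exp (-(t / (2 * (1 - t)) * a))) ≤ w z) →
    (∫⁻ x, u x ∂ν) ^ t ≤ ∫⁻ z, w z ∂ν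

theorem HasPrekopaLeindler.map {α β : Type*} [MeasurableSpace α] [MeasurableSpace β]
    {ν : Measure α} {R : α → α → ℝ → Prop} (h : HasPrekopaLeindler ν R)
    {F : α → β} (hF : Measurable F) {R' : β → β → ℝ → Prop}
    (hR : ∀ x z a, R x z a → R' (F x) (F z) a) : HasPrekopaLeindler (ν.map F) R' := by
  intro t ht0 ht1 u w hu hw H
  rw [lintegral_map hu hF, lintegral_map hw hF]
  exact h t ht0 ht1 _ _ (hu.comp hF) (hw.comp hF) fun x z a hxz => H _ _ _ (hR _ _ _ hxz)

/-- Costs add because their exponentials multiply. The inequality on the fibres over x and z, with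
the factor of the first cost moved into w, is the hypothesis needed for the fibre integrals in the
first variable. -/
theorem HasPrekopaLeindler.prod {α β : Type*} [MeasurableSpace α] [MeasurableSpace β]
    {ν₁ : Measure α} {ν₂ : Measure β} [SFinite ν₁] [SFinite ν₂]
    {R₁ : α → α → ℝ → Prop} {R₂ : β → β → ℝ → Prop}
    (h₁ : HasPrekopaLeindler ν₁ R₁) (h₂ : HasPrekopaLeindler ν₂ R₂) :
    HasPrekopaLeindler (ν₁.prod ν₂)
      (fun x z a => ∃ a₁ a₂, R₁ x.1 z.1 a₁ ∧ R₂ x.2 z.2 a₂ ∧ a = a₁ + a₂) := by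
  intro t ht0 ht1 u w hu hw H
  rw [lintegral_prod _ hu.aemeasurable, lintegral_prod _ hw.aemeasurable]
  refine h₁ t ht0 ht1 _ _ hu.lintegral_prod_right' hw.lintegral_prod_right' fun x z a₁ hxz => ?_
  set e := ENNReal.ofReal (Real.exp (-(t / (2 * (1 - t)) * a₁))) with he
  have he0 : e ≠ 0 := by simp [he, Real.exp_pos]
  have he1 : e ≠ ⊤ := ENNReal.ofReal_ne_top
  rw [← ENNReal.le_div_iff_mul_le (Or.inl he0) (Or.inl he1), div_eq_mul_inv,
    ← lintegral_mul_const _ (by fun_prop)]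
  refine h₂ t ht0 ht1 _ _ (hu.comp measurable_prodMk_left)
    ((hw.comp measurable_prodMk_left).mul_const _) fun x' z' a₂ hxz' => ?_
  rw [← div_eq_mul_inv, ENNReal.le_div_iff_mul_le (Or.inl he0) (Or.inl he1), mul_assoc, he,
    ← ENNReal.ofReal_mul (Real.exp_pos _).le, ← Real.exp_add]
  convert H (x, x') (z, z') (a₁ + a₂) ⟨a₁, a₂, hxz, hxz', rfl⟩ using 5
  ring

theorem hasPrekopaLeindler_dirac {α : Type*} [MeasurableSpace α] (x : α)
    {R : α → α → ℝ → Prop} (hR : R x x 0) : HasPrekopaLeindler (Measure.dirac x) R := by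
  intro t ht0 ht1 u w hu hw H
  rw [lintegral_dirac' _ hu, lintegral_dirac' _ hw]
  simpa using H x x 0 hR

theorem hasPrekopaLeindler_gaussianReal :
    HasPrekopaLeindler (gaussianReal 0 1) (fun x z a => (x - z) ^ 2 = a) := by
  intro t ht0 ht1 u w hu hw H
  have hs : 0 < 1 - t := by linarith
  have hφ := measurable_gaussianPDF 0 1
  rw [gaussianReal_of_var_ne_zero _ one_ne_zero]
  rw [lintegral_withDensity_eq_lintegral_mul _ hφ hu, lintegral_withDensity_eq_lintegral_mul _ hφ hw]
  have hφb : ∀ x, gaussianPDF 0 1 x ≤ 1 := by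
    intro x
    rw [gaussianPDF, gaussianPDFReal, ENNReal.ofReal_le_one]
    have h1 : 1 ≤ √(2 * Real.pi * (1 : ℝ≥0)) := by
      rw [Real.one_le_sqrt]
      have := Real.pi_gt_three
      simp only [NNReal.coe_one, mul_one]
      linarith
    refine mul_le_one₀ (inv_le_one_of_one_le₀ h1) (Real.exp_pos _).le ?_
    rw [Real.exp_le_one_iff]
    have := sq_nonneg (x - 0)
    simp only [NNReal.coe_one, mul_one]
    linarith
  -- The defect in log-concavity is t (1 - t) (x - y)² / 2, and x - z = (1 - t) (x - y) for z = t x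
  -- + (1 - t) y; this explains the coefficient t / (2 (1 - t)).
  have hpdf : ∀ x y, gaussianPDF 0 1 x ^ t * gaussianPDF 0 1 y ^ (1 - t) =
      ENNReal.ofReal (Real.exp (-(t / (2 * (1 - t)) * (x - (t * x + (1 - t) * y)) ^ 2))) *
        gaussianPDF 0 1 (t * x + (1 - t) * y) := by
    intro x y
    simp only [gaussianPDF]
    rw [ENNReal.ofReal_rpow_of_pos (gaussianPDFReal_pos _ _ _ one_ne_zero),
      ENNReal.ofReal_rpow_of_pos (gaussianPDFReal_pos _ _ _ one_ne_zero),
      ← ENNReal.ofReal_mul (Real.rpow_nonneg (gaussianPDFReal_nonneg _ _ _) _),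
      ← ENNReal.ofReal_mul (Real.exp_pos _).le]
    congr 1
    simp only [gaussianPDFReal]
    have hc : 0 < (√(2 * Real.pi * (1 : ℝ≥0)))⁻¹ := by
      have := Real.pi_pos
      simp only [NNReal.coe_one]
      positivity
    rw [Real.mul_rpow hc.le (Real.exp_pos _).le, Real.mul_rpow hc.le (Real.exp_pos _).le,
      ← Real.exp_mul, ← Real.exp_mul, mul_mul_mul_comm, ← Real.rpow_add hc, ← Real.exp_add,
      mul_left_comm, ← Real.exp_add]
    rw [show t + (1 - t) = 1 by ring, Real.rpow_one]
    congr 2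
    simp only [NNReal.coe_one]
    field_simp
    ring
  -- Truncating u meets the boundedness requirement; monotone convergence in N removes it.
  have trunc : ∀ N : ℕ, (∫⁻ x, gaussianPDF 0 1 x * min (u x) N) ^ t ≤
      ∫⁻ z, (gaussianPDF 0 1 * w) z := by
    intro N
    have h := prekopaLeindler_of_bounded ht0 ht1 (f := fun x => gaussianPDF 0 1 x * min (u x) N)
      (g := gaussianPDF 0 1) (h := gaussianPDF 0 1 * w)
      (hφ.mul (hu.min measurable_const)) hφ (hφ.mul hw) ?_ ?_ ?_
    · simpa [lintegral_gaussianPDF_eq_one] using h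
    · refine ne_top_of_le_ne_top (ENNReal.natCast_ne_top N) (iSup_le fun x => ?_)
      calc _ ≤ 1 * (N : ℝ≥0∞) := mul_le_mul' (hφb x) (min_le_right _ _)
        _ = N := one_mul _
    · exact ne_top_of_le_ne_top ENNReal.one_ne_top (iSup_le hφb)
    · intro x y
      rw [ENNReal.mul_rpow_of_nonneg _ _ ht0.le, mul_right_comm, hpdf, Pi.mul_apply]
      calc _ = (min (u x) N ^ t * ENNReal.ofReal
              (Real.exp (-(t / (2 * (1 - t)) * (x - (t * x + (1 - t) * y)) ^ 2)))) *
              gaussianPDF 0 1 (t * x + (1 - t) * y) := by ring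
        _ ≤ (u x ^ t * ENNReal.ofReal
              (Real.exp (-(t / (2 * (1 - t)) * (x - (t * x + (1 - t) * y)) ^ 2)))) *
              gaussianPDF 0 1 (t * x + (1 - t) * y) := by
            gcongr
            exact min_le_left _ _
        _ ≤ w (t * x + (1 - t) * y) * gaussianPDF 0 1 (t * x + (1 - t) * y) := by
            gcongr
            exact H x _ _ rfl
        _ = _ := mul_comm _ _
  rw [← ENNReal.le_rpow_inv_iff ht0]
  have hlim : ∀ x, (gaussianPDF 0 1 * u) x = ⨆ N : ℕ, gaussianPDF 0 1 x * min (u x) N := by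
    intro x
    rw [← ENNReal.mul_iSup, ← inf_iSup_eq, ENNReal.iSup_natCast, inf_top_eq, Pi.mul_apply]
  simp_rw [hlim]
  rw [lintegral_iSup]
  · exact iSup_le fun N => (ENNReal.le_rpow_inv_iff ht0).2 (trunc N)
  · exact fun N => hφ.mul (hu.min measurable_const)
  · intro N M hNM x
    dsimp only
    gcongr

theorem hasPrekopaLeindler_pi_gaussianReal (n : ℕ) :
    HasPrekopaLeindler (Measure.pi fun _ : Fin n => gaussianReal 0 1)
      (fun x z a => ∑ i, (x i - z i) ^ 2 = a) := by
  induction n with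
  | zero =>
    rw [Measure.pi_of_empty _ (fun i => i.elim0)]
    exact hasPrekopaLeindler_dirac _ (by simp)
  | succ n ih =>
    have hmp := (measurePreserving_piFinSuccAbove (fun _ : Fin (n + 1) => gaussianReal 0 1) 0).symm
    rw [← hmp.map_eq]
    refine (hasPrekopaLeindler_gaussianReal.prod ih).map hmp.measurable ?_
    rintro x z _ ⟨_, _, rfl, rfl, rfl⟩
    rw [Fin.sum_univ_succ]
    simp [MeasurableEquiv.piFinSuccAbove]

/-! ### Stability of the quadratic cost and Gaussian noise. -/

section Metric

variable {E : Type*} [NormedAddCommGroup E] [MeasurableSpace E]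

/-- The cost relation for the squared distance divided by `C`, which makes sense also for
`C = 0`. -/
def QuadraticCost (C : ℝ≥0) (x z : E) (a : ℝ) : Prop :=
  0 ≤ a ∧ ‖x - z‖ ^ 2 ≤ C * a

theorem HasPrekopaLeindler.map_lipschitz {ν : Measure E} {C L : ℝ≥0} [BorelSpace E]
    (h : HasPrekopaLeindler ν (QuadraticCost C)) {F : E → E} (hF : LipschitzWith L F) :
    HasPrekopaLeindler (ν.map F) (QuadraticCost (L ^ 2 * C)) := by
  refine h.map hF.continuous.measurable ?_
  rintro x z a ⟨ha, hxz⟩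
  refine ⟨ha, ?_⟩
  have h1 := hF.dist_le_mul x z
  rw [dist_eq_norm, dist_eq_norm] at h1
  calc ‖F x - F z‖ ^ 2 ≤ (L * ‖x - z‖) ^ 2 := by gcongr
    _ = L ^ 2 * ‖x - z‖ ^ 2 := mul_pow _ _ _
    _ ≤ L ^ 2 * (C * a) := by gcongr
    _ = _ := by push_cast; ring

/-- Convolution is the image of the product under addition, and Cauchy-Schwarz gives (√(C₁ a₁) +
√(C₂ a₂))² ≤ (C₁ + C₂) (a₁ + a₂). -/
theorem HasPrekopaLeindler.conv [MeasurableAdd₂ E] {ν₁ ν₂ : Measure E} [SFinite ν₁] [SFinite ν₂]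
    {C₁ C₂ : ℝ≥0} (h₁ : HasPrekopaLeindler ν₁ (QuadraticCost C₁))
    (h₂ : HasPrekopaLeindler ν₂ (QuadraticCost C₂)) :
    HasPrekopaLeindler (Measure.conv ν₁ ν₂) (QuadraticCost (C₁ + C₂)) := by
  refine (h₁.prod h₂).map measurable_add ?_
  rintro ⟨x₁, x₂⟩ ⟨z₁, z₂⟩ _ ⟨a₁, a₂, ⟨ha₁, hxz₁⟩, ⟨ha₂, hxz₂⟩, rfl⟩
  refine ⟨add_nonneg ha₁ ha₂, ?_⟩
  simp only at hxz₁ hxz₂ ⊢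
  have h1 : ‖x₁ + x₂ - (z₁ + z₂)‖ ≤ ‖x₁ - z₁‖ + ‖x₂ - z₂‖ := by
    rw [add_sub_add_comm]; exact norm_add_le _ _
  set p := ‖x₁ - z₁‖
  set q := ‖x₂ - z₂‖
  have hp : 0 ≤ p := norm_nonneg _
  have hq : 0 ≤ q := norm_nonneg _
  have hC₁ : (0 : ℝ) ≤ C₁ := C₁.2
  have hC₂ : (0 : ℝ) ≤ C₂ := C₂.2
  have hpq : 2 * (p * q) ≤ C₁ * a₂ + C₂ * a₁ := by
    refine abs_le_of_sq_le_sq' ?_ (by positivity) |>.2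
    have : p ^ 2 * q ^ 2 ≤ (C₁ * a₁) * (C₂ * a₂) := by gcongr
    nlinarith [sq_nonneg (C₁ * a₂ - C₂ * a₁)]
  calc _ ≤ (p + q) ^ 2 := by gcongr
    _ = p ^ 2 + q ^ 2 + 2 * (p * q) := by ring
    _ ≤ C₁ * a₁ + C₂ * a₂ + (C₁ * a₂ + C₂ * a₁) := by gcongr
    _ = _ := by push_cast; ring

end Metric

/-- Coordinates in an orthonormal basis preserve the squared distance, so the product Gaussian
transfers with C = 1. -/
theorem hasPrekopaLeindler_stdGaussian {ι : Type*} [Fintype ι] :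
    HasPrekopaLeindler (stdGaussian (EuclideanSpace ℝ ι)) (QuadraticCost 1) := by
  refine (hasPrekopaLeindler_pi_gaussianReal _).map (by fun_prop) ?_
  rintro x z _ rfl
  refine ⟨Finset.sum_nonneg fun i _ => sq_nonneg _, ?_⟩
  rw [← Finset.sum_sub_distrib]
  simp_rw [← sub_smul]
  have hb := (stdOrthonormalBasis ℝ (EuclideanSpace ℝ ι)).orthonormal
  rw [← real_inner_self_eq_norm_sq, hb.inner_sum]
  simp [sq]

open scoped MatrixOrder in
theorem hasPrekopaLeindler_multivariateGaussian {ι : Type*} [Fintype ι] [DecidableEq ι]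
    (v : ℝ≥0) :
    HasPrekopaLeindler (multivariateGaussian 0 ((v : ℝ) • (1 : Matrix ι ι ℝ)))
      (QuadraticCost v) := by
  have hsqrt : CFC.sqrt ((v : ℝ) • (1 : Matrix ι ι ℝ)) = (√v : ℝ) • (1 : Matrix ι ι ℝ) := by
    have h := CFC.sqrt_algebraMap (A := Matrix ι ι ℝ) (r := v)
    rw [Algebra.algebraMap_eq_smul_one, Algebra.algebraMap_eq_smul_one] at h
    simpa [NNReal.smul_def] using h
  have hL : LipschitzWith (NNReal.sqrt v) (fun x : EuclideanSpace ℝ ι => (√v : ℝ) • x) :=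
    LipschitzWith.of_dist_le_mul fun x y => by
      rw [dist_smul₀, Real.norm_of_nonneg (Real.sqrt_nonneg _)]
      simp
  have h := hasPrekopaLeindler_stdGaussian.map_lipschitz hL
  rw [NNReal.sq_sqrt, mul_one] at h
  rw [multivariateGaussian, hsqrt]
  simpa using h

/-! ### From Prékopa-Leindler to an entropy inequality. -/

open Filter Topology in
/-- The entropy estimate that follows from a Prékopa-Leindler inequality at one value of the
interpolation parameter. -/
theorem entropy_exp_le_of_rpow_lintegral_le {α : Type*} [MeasurableSpace α] {ν : Measure α}
    [IsProbabilityMeasure ν] {f q : α → ℝ} (hf : Measurable f) (hq : Measurable q) {B Q s : ℝ}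
    (hfB : ∀ x, |f x| ≤ B) (hq0 : ∀ x, 0 ≤ q x) (hqQ : ∀ x, q x ≤ Q) (hs0 : 0 < s) (hs1 : s < 1)
    (hsQ : s * Q ≤ 1)
    (H : (∫⁻ x, ENNReal.ofReal (Real.exp (f x / (1 - s))) ∂ν) ^ (1 - s) ≤
      ∫⁻ x, ENNReal.ofReal (Real.exp (f x + s * q x)) ∂ν) :
    ∫ x, f x * Real.exp (f x) ∂ν - (∫ x, Real.exp (f x) ∂ν) * Real.log (∫ x, Real.exp (f x) ∂ν) ≤
      ∫ x, q x * Real.exp (f x) ∂ν + s * Q ^ 2 * ∫ x, Real.exp (f x) ∂ν := by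
  have ht : 0 < 1 - s := by linarith
  have bdd : ∀ (g : α → ℝ) (D : ℝ), Measurable g → (∀ x, |g x| ≤ D) → Integrable g ν :=
    fun g D hg hD => Integrable.of_bound hg.aestronglyMeasurable D (Eventually.of_forall hD)
  have hfexp : ∀ x, |Real.exp (f x)| ≤ Real.exp B := fun x => by
    rw [Real.abs_exp]; exact Real.exp_le_exp.2 (abs_le.1 (hfB x)).2
  have iexp : Integrable (fun x => Real.exp (f x)) ν := bdd _ _ hf.exp hfexp
  have ifexp : Integrable (fun x => f x * Real.exp (f x)) ν :=
    bdd _ (B * Real.exp B) (hf.mul hf.exp) fun x => by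
      rw [abs_mul]
      exact mul_le_mul (hfB x) (hfexp x) (abs_nonneg _) ((abs_nonneg _).trans (hfB x))
  have iqexp : Integrable (fun x => q x * Real.exp (f x)) ν :=
    bdd _ (Q * Real.exp B) (hq.mul hf.exp) fun x => by
      rw [abs_mul, abs_of_nonneg (hq0 x)]
      exact mul_le_mul (hqQ x) (hfexp x) (abs_nonneg _) ((hq0 x).trans (hqQ x))
  have iexpt : Integrable (fun x => Real.exp (f x / (1 - s))) ν :=
    bdd _ (Real.exp (B / (1 - s))) (hf.div_const _).exp fun x => by
      rw [Real.abs_exp, Real.exp_le_exp]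
      exact div_le_div_of_nonneg_right (abs_le.1 (hfB x)).2 ht.le
  have iexpq : Integrable (fun x => Real.exp (f x + s * q x)) ν :=
    bdd _ (Real.exp (B + s * Q)) (hf.add (hq.const_mul s)).exp fun x => by
      rw [Real.abs_exp, Real.exp_le_exp]
      exact add_le_add (abs_le.1 (hfB x)).2 (mul_le_mul_of_nonneg_left (hqQ x) hs0.le)
  set M := ∫ x, Real.exp (f x) ∂ν with hM
  have hMpos : 0 < M := integral_exp_pos iexp
  have H' : (∫ x, Real.exp (f x / (1 - s)) ∂ν) ^ (1 - s) ≤ ∫ x, Real.exp (f x + s * q x) ∂ν := by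
    rw [← ofReal_integral_eq_lintegral_ofReal iexpt
        (Eventually.of_forall fun x => (Real.exp_pos _).le),
      ← ofReal_integral_eq_lintegral_ofReal iexpq
        (Eventually.of_forall fun x => (Real.exp_pos _).le),
      ENNReal.ofReal_rpow_of_nonneg (integral_nonneg fun x => (Real.exp_pos _).le) ht.le] at H
    exact (ENNReal.ofReal_le_ofReal_iff (integral_nonneg fun x => (Real.exp_pos _).le)).1 H
  set m := (∫ x, f x * Real.exp (f x) ∂ν) / M with hm
  have hmM : ∫ x, f x * Real.exp (f x) ∂ν = m * M := by rw [hm]; field_simp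
  set c := s / (1 - s) * m with hc
  -- Jensen for the probability measure exp(f) ν / M, written as a tangent-line bound at c, the mean
  -- of s / (1 - s) * f under it.
  have lower : M * Real.exp c ≤ ∫ x, Real.exp (f x / (1 - s)) ∂ν := by
    calc M * Real.exp c = ∫ x, ((1 - c) * Real.exp c * Real.exp (f x) +
          s / (1 - s) * Real.exp c * (f x * Real.exp (f x))) ∂ν := by
          rw [integral_add (iexp.const_mul _) (ifexp.const_mul _), integral_const_mul,
            integral_const_mul, hmM, ← hM, hc]
          ring
      _ ≤ _ := by
          refine integral_mono ((iexp.const_mul _).add (ifexp.const_mul _)) iexpt fun x => ?_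
          have h1 : Real.exp (f x / (1 - s)) =
              Real.exp (f x) * Real.exp c * Real.exp (s / (1 - s) * f x - c) := by
            rw [← Real.exp_add, ← Real.exp_add]
            congr 1
            field_simp
            ring
          have h2 := Real.add_one_le_exp (s / (1 - s) * f x - c)
          have h3 : 0 < Real.exp (f x) * Real.exp c := by positivity
          simp only
          rw [h1]
          nlinarith [mul_le_mul_of_nonneg_left h2 h3.le]
  -- Uses exp y ≤ 1 + y + y² for 0 ≤ y ≤ 1, with y = s * q x; `hsQ` keeps y in this range.
  have upper : ∫ x, Real.exp (f x + s * q x) ∂ν ≤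
      M + s * ∫ x, q x * Real.exp (f x) ∂ν + s ^ 2 * Q ^ 2 * M := by
    calc _ ≤ ∫ x, (Real.exp (f x) + s * (q x * Real.exp (f x)) +
          s ^ 2 * Q ^ 2 * Real.exp (f x)) ∂ν := by
          refine integral_mono iexpq ((iexp.add (iqexp.const_mul _)).add (iexp.const_mul _))
            fun x => ?_
          have hsq0 : 0 ≤ s * q x := mul_nonneg hs0.le (hq0 x)
          have hsqQ : s * q x ≤ s * Q := mul_le_mul_of_nonneg_left (hqQ x) hs0.le
          have h1 := (abs_le.1 (Real.abs_exp_sub_one_sub_id_le (x := s * q x)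
            (by rw [abs_of_nonneg hsq0]; exact hsqQ.trans hsQ))).2
          have h2 : (s * q x) ^ 2 ≤ (s * Q) ^ 2 := by gcongr
          simp only
          rw [Real.exp_add]
          nlinarith [mul_le_mul_of_nonneg_left (h1.trans h2) (Real.exp_pos (f x)).le]
      _ = _ := by
          have i4 : Integrable (fun x => Real.exp (f x) + s * (q x * Real.exp (f x))) ν :=
            iexp.add (iqexp.const_mul _)
          rw [integral_add i4 (iexp.const_mul _),
            integral_add iexp (iqexp.const_mul _), integral_const_mul, integral_const_mul]
  set A := (∫ x, q x * Real.exp (f x) ∂ν) / M + s * Q ^ 2 with hA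
  have hAM : M + s * ∫ x, q x * Real.exp (f x) ∂ν + s ^ 2 * Q ^ 2 * M = M * (s * A + 1) := by
    rw [hA]; field_simp; ring
  have chain : Real.exp ((1 - s) * (Real.log M + c)) ≤ Real.exp (Real.log M + s * A) := by
    calc Real.exp ((1 - s) * (Real.log M + c)) = (M * Real.exp c) ^ (1 - s) := by
          rw [mul_comm, Real.exp_mul, Real.exp_add, Real.exp_log hMpos]
      _ ≤ (∫ x, Real.exp (f x / (1 - s)) ∂ν) ^ (1 - s) := by gcongr
      _ ≤ M * (s * A + 1) := hAM ▸ H'.trans upper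
      _ ≤ M * Real.exp (s * A) := by gcongr; exact Real.add_one_le_exp _
      _ = _ := by rw [Real.exp_add, Real.exp_log hMpos]
  rw [Real.exp_le_exp] at chain
  have hsc : (1 - s) * c = s * m := by rw [hc]; field_simp
  have h1 : s * (m - Real.log M) ≤ s * A := by nlinarith
  have h2 := le_of_mul_le_mul_left h1 hs0
  have h3 := mul_le_mul_of_nonneg_right h2 hMpos.le
  have h4 : A * M = ∫ x, q x * Real.exp (f x) ∂ν + s * Q ^ 2 * M := by rw [hA]; field_simp
  rw [hmM]
  linarith

section

variable {E : Type*} [NormedAddCommGroup E] [NormedSpace ℝ E]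

theorem HasCompactSupport.exists_sub_le_norm_fderiv_add_mul {f : E → ℝ} (hf : ContDiff ℝ 1 f)
    (hfc : HasCompactSupport f) {ε : ℝ} (hε : 0 < ε) :
    ∃ δ > 0, ∀ x z, ‖x - z‖ < δ → f x - f z ≤ (‖fderiv ℝ f z‖ + ε) * ‖x - z‖ := by
  have huc : UniformContinuous (fderiv ℝ f) :=
    (hfc.fderiv (𝕜 := ℝ)).uniformContinuous_of_continuous (hf.continuous_fderiv one_ne_zero)
  obtain ⟨δ, hδ, H⟩ := Metric.uniformContinuous_iff.1 huc ε hε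
  refine ⟨δ, hδ, fun x z hxz => ?_⟩
  refine (le_abs_self _).trans ?_
  refine (convex_ball z δ).norm_image_sub_le_of_norm_fderiv_le (𝕜 := ℝ) (f := f)
    (fun y _ => (hf.differentiable one_ne_zero).differentiableAt) (fun y hy => ?_)
    (Metric.mem_ball_self hδ) (by rwa [Metric.mem_ball, dist_eq_norm])
  have h1 := (H hy).le
  rw [dist_eq_norm] at h1
  calc ‖fderiv ℝ f y‖ = ‖fderiv ℝ f z + (fderiv ℝ f y - fderiv ℝ f z)‖ := by congr 1; abel
    _ ≤ _ := (norm_add_le _ _).trans (by gcongr)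

/-- An upper bound for the sup-convolution of `f` with the cost `QuadraticCost C`, to first order
in the parameter `s`. -/
theorem HasCompactSupport.exists_sub_quadraticCost_le {f : E → ℝ} (hf : ContDiff ℝ 1 f)
    (hfc : HasCompactSupport f) (C : ℝ≥0) {ε : ℝ} (hε : 0 < ε) :
    ∃ s₀ > 0, ∀ s, 0 < s → s < s₀ → s < 1 → ∀ x z a, QuadraticCost C x z a →
      f x - (1 - s) / (2 * s) * a ≤
        f z + s * (C / (2 * (1 - s)) * (‖fderiv ℝ f z‖ + ε) ^ 2) := by
  obtain ⟨δ, hδ, H⟩ := hfc.exists_sub_le_norm_fderiv_add_mul hf hε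
  obtain ⟨K, hK⟩ := (hfc.fderiv (𝕜 := ℝ)).exists_bound_of_continuous
    (hf.continuous_fderiv one_ne_zero)
  have hK0 : 0 ≤ K := (norm_nonneg _).trans (hK 0)
  have hC : (0 : ℝ) ≤ C := C.2
  have hlip : ∀ x z, f x - f z ≤ K * ‖x - z‖ := fun x z =>
    (le_abs_self _).trans (convex_univ.norm_image_sub_le_of_norm_fderiv_le (𝕜 := ℝ) (f := f)
      (fun y _ => (hf.differentiable one_ne_zero).differentiableAt) (fun y _ => hK y)
      (Set.mem_univ _) (Set.mem_univ _))
  -- This threshold makes 2 K C s ≤ (1 - s) δ, so at distance at least δ the cost outweighs the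
  -- global Lipschitz bound K ‖x - z‖.
  refine ⟨δ / (2 * K * C + δ), by positivity, fun s hs0 hs hs1 x z a ⟨ha, hxz⟩ => ?_⟩
  have ht : 0 < 1 - s := by linarith
  have hsδ : 2 * K * C * s ≤ (1 - s) * δ := by
    rw [lt_div_iff₀ (by positivity)] at hs
    linarith
  rcases lt_or_ge ‖x - z‖ δ with h | h
  · have h1 := H x z h
    set k := ‖fderiv ℝ f z‖ + ε
    have hk : 0 ≤ k := by positivity
    -- AM-GM, with the two terms on the right having product k² C a / 4.
    have h2 : k * ‖x - z‖ ≤ s * (C / (2 * (1 - s)) * k ^ 2) + (1 - s) / (2 * s) * a := by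
      refine abs_le_of_sq_le_sq' ?_ (by positivity) |>.2
      have e : s * (C / (2 * (1 - s)) * k ^ 2) * ((1 - s) / (2 * s) * a) * 4 = k ^ 2 * (C * a) := by
        field_simp
        ring
      calc (k * ‖x - z‖) ^ 2 = k ^ 2 * ‖x - z‖ ^ 2 := mul_pow _ _ _
        _ ≤ k ^ 2 * (C * a) := by gcongr
        _ ≤ _ := by
          rw [← e]
          nlinarith [sq_nonneg (s * (C / (2 * (1 - s)) * k ^ 2) - (1 - s) / (2 * s) * a)]
    linarith
  · have h1 := hlip x z
    have h2 : K * ‖x - z‖ ≤ (1 - s) / (2 * s) * a := by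
      rw [div_mul_eq_mul_div, le_div_iff₀ (by positivity)]
      have h3 : K * ‖x - z‖ * (2 * s) * δ ≤ (1 - s) * a * δ := by
        calc K * ‖x - z‖ * (2 * s) * δ ≤ K * ‖x - z‖ * (2 * s) * ‖x - z‖ := by gcongr
          _ = 2 * K * s * ‖x - z‖ ^ 2 := by ring
          _ ≤ 2 * K * s * (C * a) := by gcongr
          _ = 2 * K * C * s * a := by ring
          _ ≤ (1 - s) * δ * a := by gcongr
          _ = _ := by ring
      exact le_of_mul_le_mul_right h3 hδ
    have h3 : 0 ≤ s * (C / (2 * (1 - s)) * (‖fderiv ℝ f z‖ + ε) ^ 2) := by positivity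
    linarith

variable [MeasurableSpace E] [BorelSpace E]

/-- The sup-convolution bound supplies an admissible w for u = exp(f / (1 - s)). First s → 0 at
fixed ε, then ε → 0; compact support gives the uniform control of `fderiv ℝ f`. -/
theorem HasPrekopaLeindler.entropy_exp_le_of_hasCompactSupport {ν : Measure E}
    [IsProbabilityMeasure ν] {C : ℝ≥0} (hν : HasPrekopaLeindler ν (QuadraticCost C))
    {f : E → ℝ} (hf : ContDiff ℝ 1 f) (hfc : HasCompactSupport f) :
    ∫ x, f x * Real.exp (f x) ∂ν - (∫ x, Real.exp (f x) ∂ν) * Real.log (∫ x, Real.exp (f x) ∂ν) ≤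
      C / 2 * ∫ x, ‖fderiv ℝ f x‖ ^ 2 * Real.exp (f x) ∂ν := by
  obtain ⟨B, hB⟩ := hfc.exists_bound_of_continuous hf.continuous
  have hf' := hf.continuous_fderiv one_ne_zero
  obtain ⟨K, hK⟩ := (hfc.fderiv (𝕜 := ℝ)).exists_bound_of_continuous hf'
  have hK0 : 0 ≤ K := (norm_nonneg _).trans (hK 0)
  have hC : (0 : ℝ) ≤ C := C.2
  have hfm := hf.continuous.measurable
  have hf'm : Measurable fun x => ‖fderiv ℝ f x‖ := hf'.norm.measurable
  have hexp : ∀ x, Real.exp (f x) ≤ Real.exp B := fun x =>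
    Real.exp_le_exp.2 (abs_le.1 (hB x)).2
  set Ent := ∫ x, f x * Real.exp (f x) ∂ν -
    (∫ x, Real.exp (f x) ∂ν) * Real.log (∫ x, Real.exp (f x) ∂ν)
  set M := ∫ x, Real.exp (f x) ∂ν
  have key : ∀ ε : ℝ, 0 < ε →
      Ent ≤ C / 2 * ∫ x, (‖fderiv ℝ f x‖ + ε) ^ 2 * Real.exp (f x) ∂ν := by
    intro ε hε
    obtain ⟨s₀, hs₀, H⟩ := hfc.exists_sub_quadraticCost_le hf C hε
    set Q : ℝ := C * (K + ε) ^ 2 with hQ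
    set I := ∫ x, (‖fderiv ℝ f x‖ + ε) ^ 2 * Real.exp (f x) ∂ν
    have hQ0 : 0 ≤ Q := by positivity
    have step : ∀ᶠ s in nhdsWithin (0 : ℝ) (Set.Ioi 0),
        Ent ≤ C / (2 * (1 - s)) * I + s * Q ^ 2 * M := by
      -- The bound 1/2 gives C / (2 (1 - s)) ≤ C, hence q ≤ Q; the bound 1 / (Q + 1) gives s Q ≤ 1.
      have hpos : 0 < min s₀ (min (1 / 2) (1 / (Q + 1))) := by positivity
      filter_upwards [Ioo_mem_nhdsGT hpos] with s ⟨hs0, hs⟩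
      simp only [lt_min_iff] at hs
      obtain ⟨hss₀, hs2, hsQ⟩ := hs
      have hs1 : s < 1 := by linarith
      have ht : 0 < 1 - s := by linarith
      have hPL := hν (1 - s) ht (by linarith) (fun x => ENNReal.ofReal (Real.exp (f x / (1 - s))))
        (fun x => ENNReal.ofReal
          (Real.exp (f x + s * (C / (2 * (1 - s)) * (‖fderiv ℝ f x‖ + ε) ^ 2))))
        (by fun_prop) (by fun_prop) (fun x z a hxz => by
          rw [ENNReal.ofReal_rpow_of_pos (Real.exp_pos _), ← ENNReal.ofReal_mul (by positivity),
            ← Real.exp_mul, ← Real.exp_add, div_mul_cancel₀ _ ht.ne']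
          refine ENNReal.ofReal_le_ofReal (Real.exp_le_exp.2 ?_)
          have h1 := H s hs0 hss₀ hs1 x z a hxz
          rw [sub_sub_cancel]
          linarith)
      have h := entropy_exp_le_of_rpow_lintegral_le (Q := Q) hfm (by fun_prop) hB
        (fun x => by positivity) (fun x => ?_) hs0 hs1 ?_ hPL
      · refine h.trans_eq ?_
        congr 1
        simp_rw [mul_assoc (C / (2 * (1 - s)) : ℝ)]
        rw [integral_const_mul]
      · rw [hQ]
        have : (C : ℝ) / (2 * (1 - s)) ≤ C := div_le_self hC (by linarith)
        gcongr
        exact hK x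
      · rw [lt_div_iff₀ (by positivity)] at hsQ
        nlinarith
    refine ge_of_tendsto (f := fun s : ℝ => C / (2 * (1 - s)) * I + s * Q ^ 2 * M) ?_ step
    have hcont : ContinuousAt (fun s : ℝ => C / (2 * (1 - s)) * I + s * Q ^ 2 * M) 0 := by
      have : (2 * (1 - (0 : ℝ))) ≠ 0 := by norm_num
      fun_prop (disch := assumption)
    have := hcont.tendsto
    simp only [sub_zero, mul_one, zero_mul, add_zero] at this
    exact this.mono_left nhdsWithin_le_nhds
  have bdd : ∀ (g : E → ℝ) (D : ℝ), Measurable g → (∀ x, 0 ≤ g x) → (∀ x, g x ≤ D) →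
      Integrable (fun x => g x * Real.exp (f x)) ν :=
    fun g D hg hg0 hD => Integrable.of_bound (hg.mul hfm.exp).aestronglyMeasurable
      (D * Real.exp B) (Filter.Eventually.of_forall fun x => by
        rw [Real.norm_of_nonneg (mul_nonneg (hg0 x) (Real.exp_pos _).le)]
        exact mul_le_mul (hD x) (hexp x) (Real.exp_pos _).le ((hg0 x).trans (hD x)))
  have i1 := bdd (fun x => ‖fderiv ℝ f x‖) K hf'm (fun x => norm_nonneg _) hK
  have i2 := bdd (fun x => ‖fderiv ℝ f x‖ ^ 2) (K ^ 2) (hf'm.pow_const 2)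
    (fun x => by positivity) (fun x => by gcongr; exact hK x)
  have i3 := bdd (fun x => 1) 1 measurable_const (fun x => zero_le_one) (fun x => le_rfl)
  set J := ∫ x, ‖fderiv ℝ f x‖ ^ 2 * Real.exp (f x) ∂ν
  set J1 := ∫ x, ‖fderiv ℝ f x‖ * Real.exp (f x) ∂ν
  have expand : ∀ ε : ℝ, ∫ x, (‖fderiv ℝ f x‖ + ε) ^ 2 * Real.exp (f x) ∂ν =
      J + 2 * ε * J1 + ε ^ 2 * ∫ x, 1 * Real.exp (f x) ∂ν := by
    intro ε
    have i4 : Integrable (fun x => ‖fderiv ℝ f x‖ ^ 2 * Real.exp (f x) +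
        2 * ε * (‖fderiv ℝ f x‖ * Real.exp (f x))) ν := i2.add (i1.const_mul _)
    rw [← integral_const_mul, ← integral_const_mul, ← integral_add i2 (i1.const_mul _),
      ← integral_add i4 (i3.const_mul _)]
    congr 1
    ext x
    ring
  refine ge_of_tendsto (f := fun ε : ℝ =>
    C / 2 * (J + 2 * ε * J1 + ε ^ 2 * ∫ x, 1 * Real.exp (f x) ∂ν))
    (x := nhdsWithin (0 : ℝ) (Set.Ioi 0)) ?_ ?_
  · have hcont : ContinuousAt (fun ε : ℝ =>
        C / 2 * (J + 2 * ε * J1 + ε ^ 2 * ∫ x, 1 * Real.exp (f x) ∂ν)) 0 := by fun_prop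
    have := hcont.tendsto
    simp only [mul_zero, zero_mul, add_zero, ne_eq, OfNat.ofNat_ne_zero, not_false_eq_true,
      zero_pow] at this
    exact this.mono_left nhdsWithin_le_nhds
  · filter_upwards [self_mem_nhdsWithin] with ε hε
    rw [← expand]
    exact key ε hε

end

/-! ### Removing compact support and boundedness: the log-Sobolev inequality. -/

section

open Filter Topology

variable {E : Type*} [NormedAddCommGroup E] [InnerProductSpace ℝ E] [FiniteDimensional ℝ E]

/-- Smooth cutoff functions with values in `[0, 1]` and small gradient. -/
theorem exists_cutoff : ∃ (χ : ℕ → E → ℝ) (K : ℝ), 0 ≤ K ∧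
    (∀ n, ContDiff ℝ 1 (χ n)) ∧ (∀ n, HasCompactSupport (χ n)) ∧ (∀ n x, 0 ≤ χ n x) ∧
    (∀ n x, χ n x ≤ 1) ∧ (∀ n x, ‖fderiv ℝ (χ n) x‖ ≤ K * (1 / ((n : ℝ) + 1))) ∧
    ∀ x, ∀ᶠ n in atTop, χ n x = 1 := by
  let φ : ContDiffBump (0 : E) := ⟨1, 2, one_pos, one_lt_two⟩
  have hφ : ContDiff ℝ 1 φ := φ.contDiff
  obtain ⟨K, hK⟩ := (φ.hasCompactSupport.fderiv (𝕜 := ℝ)).exists_bound_of_continuous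
    (hφ.continuous_fderiv one_ne_zero)
  have hpos : ∀ n : ℕ, (0 : ℝ) < 1 / ((n : ℝ) + 1) := fun n => Nat.one_div_pos_of_nat
  refine ⟨fun n x => φ ((1 / ((n : ℝ) + 1)) • x), K, (norm_nonneg _).trans (hK 0),
    fun n => hφ.comp (contDiff_const_smul _),
    fun n => φ.hasCompactSupport.comp_smul (hpos n).ne', fun n x => φ.nonneg, fun n x => φ.le_one,
    fun n x => ?_, fun x => ?_⟩
  · rw [fderiv_comp_smul, norm_smul, Real.norm_of_nonneg (hpos n).le, mul_comm]
    exact mul_le_mul_of_nonneg_right (hK _) (hpos n).le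
  · have h : Tendsto (fun n : ℕ => (1 / ((n : ℝ) + 1)) • x) atTop (𝓝 0) := by
      simpa using (tendsto_one_div_add_atTop_nhds_zero_nat (𝕜 := ℝ)).smul_const x
    filter_upwards [h (Metric.closedBall_mem_nhds 0 one_pos)] with n hn
    exact φ.one_of_mem_closedBall hn

variable [MeasurableSpace E] [BorelSpace E]

theorem HasPrekopaLeindler.entropy_exp_le_of_bounded {ν : Measure E}
    [IsProbabilityMeasure ν] {C : ℝ≥0} (hν : HasPrekopaLeindler ν (QuadraticCost C))
    {f : E → ℝ} (hf : ContDiff ℝ 1 f) {B : ℝ} (hB : ∀ x, |f x| ≤ B)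
    (hfi : Integrable (fun x => ‖fderiv ℝ f x‖ ^ 2) ν) :
    ∫ x, f x * Real.exp (f x) ∂ν - (∫ x, Real.exp (f x) ∂ν) * Real.log (∫ x, Real.exp (f x) ∂ν) ≤
      C / 2 * ∫ x, ‖fderiv ℝ f x‖ ^ 2 * Real.exp (f x) ∂ν := by
  obtain ⟨χ, K, hK, hχ, hχc, hχ0, hχ1, hχK, hχt⟩ := exists_cutoff (E := E)
  have hB0 : 0 ≤ B := (abs_nonneg _).trans (hB 0)
  let F : ℕ → E → ℝ := fun n x => χ n x * f x
  have hF : ∀ n, ContDiff ℝ 1 (F n) := fun n => (hχ n).mul hf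
  have hFB : ∀ n x, |F n x| ≤ B := fun n x => by
    rw [abs_mul, abs_of_nonneg (hχ0 n x)]
    exact (mul_le_of_le_one_left (abs_nonneg _) (hχ1 n x)).trans (hB x)
  have hFexp : ∀ n x, Real.exp (F n x) ≤ Real.exp B := fun n x =>
    Real.exp_le_exp.2 (abs_le.1 (hFB n x)).2
  have hFt : ∀ x, Tendsto (fun n => F n x) atTop (𝓝 (f x)) := fun x =>
    tendsto_const_nhds.congr' <| (hχt x).mono fun n hn => by simp [F, hn]
  -- Differentiating the cutoff costs only O(1 / n) because f is bounded.
  have hdF : ∀ n x, ‖fderiv ℝ (F n) x‖ ≤ ‖fderiv ℝ f x‖ + B * K * (1 / ((n : ℝ) + 1)) := by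
    intro n x
    have h1 := (((hχ n).differentiable one_ne_zero x).hasFDerivAt.mul
      (hf.differentiable one_ne_zero x).hasFDerivAt).fderiv
    rw [show F n = χ n * f from rfl, h1]
    refine (norm_add_le _ _).trans ?_
    rw [norm_smul, norm_smul, Real.norm_of_nonneg (hχ0 n x), Real.norm_eq_abs, mul_assoc]
    exact add_le_add (mul_le_of_le_one_left (norm_nonneg _) (hχ1 n x))
      (mul_le_mul (hB x) (hχK n x) (norm_nonneg _) hB0)
  have hpos : ∀ n : ℕ, (0 : ℝ) < 1 / ((n : ℝ) + 1) := fun n => Nat.one_div_pos_of_nat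
  have hle1 : ∀ n : ℕ, 1 / ((n : ℝ) + 1) ≤ 1 := fun n =>
    div_le_one_of_le₀ (by linarith [n.cast_nonneg (α := ℝ)]) (by positivity)
  have hfm := hf.continuous.measurable
  have hf'm : Measurable fun x => ‖fderiv ℝ f x‖ :=
    (hf.continuous_fderiv one_ne_zero).norm.measurable
  have hFm : ∀ n, Measurable (F n) := fun n => (hF n).continuous.measurable
  have hF'm : ∀ n, Measurable fun x => ‖fderiv ℝ (F n) x‖ := fun n =>
    ((hF n).continuous_fderiv one_ne_zero).norm.measurable
  let G : ℕ → E → ℝ := fun n x =>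
    (‖fderiv ℝ f x‖ + B * K * (1 / ((n : ℝ) + 1))) ^ 2 * Real.exp (F n x)
  have hGbound : ∀ n x, G n x ≤ (2 * ‖fderiv ℝ f x‖ ^ 2 + 2 * (B * K) ^ 2) * Real.exp B := by
    intro n x
    have h1 : B * K * (1 / ((n : ℝ) + 1)) ≤ B * K :=
      mul_le_of_le_one_right (by positivity) (hle1 n)
    have h2 : (‖fderiv ℝ f x‖ + B * K * (1 / ((n : ℝ) + 1))) ^ 2 ≤
        (‖fderiv ℝ f x‖ + B * K) ^ 2 := by
      have := hpos n
      gcongr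
    have h3 : (‖fderiv ℝ f x‖ + B * K) ^ 2 ≤ 2 * ‖fderiv ℝ f x‖ ^ 2 + 2 * (B * K) ^ 2 := by
      nlinarith [sq_nonneg (‖fderiv ℝ f x‖ - B * K)]
    exact mul_le_mul (h2.trans h3) (hFexp n x) (Real.exp_pos _).le (by positivity)
  have ibound : Integrable
      (fun x => (2 * ‖fderiv ℝ f x‖ ^ 2 + 2 * (B * K) ^ 2) * Real.exp B) ν :=
    ((hfi.const_mul 2).add (integrable_const _)).mul_const _
  have hGm : ∀ n, Measurable (G n) := fun n =>
    ((hf'm.add_const _).pow_const 2).mul (hFm n).exp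
  have hGnorm : ∀ n x, ‖G n x‖ = G n x := fun n x => Real.norm_of_nonneg (by positivity)
  have step : ∀ n, ∫ x, F n x * Real.exp (F n x) ∂ν -
      (∫ x, Real.exp (F n x) ∂ν) * Real.log (∫ x, Real.exp (F n x) ∂ν) ≤
        C / 2 * ∫ x, G n x ∂ν := by
    intro n
    refine (hν.entropy_exp_le_of_hasCompactSupport (hF n) ((hχc n).mul_right)).trans ?_
    have hC : (0 : ℝ) ≤ C := C.2
    refine mul_le_mul_of_nonneg_left ?_ (by positivity)
    refine integral_mono_of_nonneg (Eventually.of_forall fun x => by positivity)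
      (ibound.mono' (hGm n).aestronglyMeasurable
        (Eventually.of_forall fun x => (hGnorm n x).trans_le (hGbound n x)))
      (Eventually.of_forall fun x => ?_)
    have := hdF n x
    dsimp only [G]
    gcongr
  have t1 : Tendsto (fun n => ∫ x, F n x * Real.exp (F n x) ∂ν) atTop
      (𝓝 (∫ x, f x * Real.exp (f x) ∂ν)) := by
    refine tendsto_integral_of_dominated_convergence (fun _ => B * Real.exp B)
      (fun n => ((hFm n).mul (hFm n).exp).aestronglyMeasurable) (integrable_const _)
      (fun n => Eventually.of_forall fun x => ?_)
      (Eventually.of_forall fun x => (hFt x).mul (hFt x).rexp)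
    rw [norm_mul, Real.norm_of_nonneg (Real.exp_pos _).le]
    exact mul_le_mul (hFB n x) (hFexp n x) (Real.exp_pos _).le hB0
  have t2 : Tendsto (fun n => ∫ x, Real.exp (F n x) ∂ν) atTop (𝓝 (∫ x, Real.exp (f x) ∂ν)) := by
    refine tendsto_integral_of_dominated_convergence (fun _ => Real.exp B)
      (fun n => (hFm n).exp.aestronglyMeasurable) (integrable_const _)
      (fun n => Eventually.of_forall fun x => ?_) (Eventually.of_forall fun x => (hFt x).rexp)
    rw [Real.norm_of_nonneg (Real.exp_pos _).le]
    exact hFexp n x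
  have t3 : Tendsto (fun n => ∫ x, G n x ∂ν) atTop
      (𝓝 (∫ x, ‖fderiv ℝ f x‖ ^ 2 * Real.exp (f x) ∂ν)) := by
    refine tendsto_integral_of_dominated_convergence _ (fun n => (hGm n).aestronglyMeasurable)
      ibound (fun n => Eventually.of_forall fun x => (hGnorm n x).trans_le (hGbound n x))
      (Eventually.of_forall fun x => ?_)
    refine Tendsto.mul ?_ (hFt x).rexp
    have h := ((tendsto_one_div_add_atTop_nhds_zero_nat (𝕜 := ℝ)).const_mul (B * K)).const_add
      ‖fderiv ℝ f x‖
    rw [mul_zero, add_zero] at h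
    exact h.pow 2
  exact le_of_tendsto_of_tendsto'
    (t1.sub ((Real.continuous_mul_log.tendsto _).comp t2)) (t3.const_mul _) step

/-- Fatou's lemma for real-valued functions with a common lower bound. -/
theorem integrable_and_integral_le_of_tendsto {α : Type*} [MeasurableSpace α] {ν : Measure α}
    [IsProbabilityMeasure ν] {F : ℕ → α → ℝ} {f : α → ℝ} {a : ℕ → ℝ} {b : ℝ}
    (hFm : ∀ n, Measurable (F n)) (hFi : ∀ n, Integrable (F n) ν) (hF : ∀ n x, -1 ≤ F n x)
    (hlim : ∀ x, Tendsto (fun n => F n x) atTop (𝓝 (f x))) (ha : ∀ n, ∫ x, F n x ∂ν ≤ a n)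
    (hab : Tendsto a atTop (𝓝 b)) : Integrable f ν ∧ ∫ x, f x ∂ν ≤ b := by
  have hfm : Measurable f := measurable_of_tendsto_metrizable hFm (tendsto_pi_nhds.2 hlim)
  have hf : ∀ x, 0 ≤ f x + 1 := fun x => by
    linarith [ge_of_tendsto' (hlim x) fun n => hF n x]
  have hint : ∀ n, ∫ x, (F n x + 1) ∂ν = ∫ x, F n x ∂ν + 1 := fun n => by
    rw [integral_add (hFi n) (integrable_const _)]; simp
  have ha1 : ∀ n, 0 ≤ a n + 1 := fun n => by
    have h1 : 0 ≤ ∫ x, (F n x + 1) ∂ν := integral_nonneg fun x => by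
      simp only [Pi.zero_apply]; linarith [hF n x]
    linarith [hint n, ha n]
  have hb1 : 0 ≤ b + 1 := ge_of_tendsto' (hab.add_const 1) ha1
  have key : ∫⁻ x, ENNReal.ofReal (f x + 1) ∂ν ≤ ENNReal.ofReal (b + 1) := by
    calc ∫⁻ x, ENNReal.ofReal (f x + 1) ∂ν =
          ∫⁻ x, liminf (fun n => ENNReal.ofReal (F n x + 1)) atTop ∂ν := by
          congr 1
          ext x
          exact (ENNReal.tendsto_ofReal ((hlim x).add_const 1)).liminf_eq.symm
      _ ≤ liminf (fun n => ∫⁻ x, ENNReal.ofReal (F n x + 1) ∂ν) atTop :=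
          lintegral_liminf_le fun n => ((hFm n).add_const 1).ennreal_ofReal
      _ ≤ liminf (fun n => ENNReal.ofReal (a n + 1)) atTop := by
          refine liminf_le_liminf (Eventually.of_forall fun n => ?_)
          have hi : Integrable (fun x => F n x + 1) ν := (hFi n).add (integrable_const 1)
          rw [← ofReal_integral_eq_lintegral_ofReal hi
            (Eventually.of_forall fun x => by simp only [Pi.zero_apply]; linarith [hF n x]), hint]
          exact ENNReal.ofReal_le_ofReal (by linarith [ha n])
      _ = ENNReal.ofReal (b + 1) := (ENNReal.tendsto_ofReal (hab.add_const 1)).liminf_eq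
  have hf1i : Integrable (fun x => f x + 1) ν := by
    refine ⟨(hfm.add_const 1).aestronglyMeasurable, ?_⟩
    rw [hasFiniteIntegral_iff_ofReal (Eventually.of_forall hf)]
    exact key.trans_lt ENNReal.ofReal_lt_top
  have hfi : Integrable f ν := by
    simpa [Pi.sub_def] using hf1i.sub (integrable_const (1 : ℝ))
  refine ⟨hfi, ?_⟩
  rw [← ofReal_integral_eq_lintegral_ofReal hf1i (Eventually.of_forall hf),
    ENNReal.ofReal_le_ofReal_iff hb1, integral_add hfi (integrable_const _)] at key
  simp only [integral_const, probReal_univ, smul_eq_mul, mul_one] at key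
  linarith

/-- A regularization of `y ^ 2`, bounded above and away from zero. -/
noncomputable def regSq (δ y : ℝ) : ℝ := δ + y ^ 2 / (1 + δ * y ^ 2)

theorem le_regSq {δ : ℝ} (hδ : 0 < δ) (y : ℝ) : δ ≤ regSq δ y := le_add_of_nonneg_right (by positivity)

theorem regSq_le {δ : ℝ} (hδ : 0 < δ) (y : ℝ) : regSq δ y ≤ δ + 1 / δ := by
  refine add_le_add_right ?_ δ
  rw [div_le_div_iff₀ (by positivity) hδ]
  linarith

theorem regSq_le_add_sq {δ : ℝ} (hδ : 0 < δ) (y : ℝ) : regSq δ y ≤ δ + y ^ 2 := by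
  unfold regSq
  gcongr
  exact div_le_self (sq_nonneg _) (le_add_of_nonneg_right (by positivity))

theorem hasDerivAt_regSq {δ : ℝ} (hδ : 0 < δ) (y : ℝ) : HasDerivAt (regSq δ) (2 * y / (1 + δ * y ^ 2) ^ 2) y := by
  have h0 : 1 + δ * y ^ 2 ≠ 0 := by positivity
  have h1 := hasDerivAt_pow 2 y
  refine HasDerivAt.congr_deriv ((h1.div ((h1.const_mul δ).const_add 1) h0).const_add δ) ?_
  congr 1
  push_cast
  ring

/-- For y² itself this is an equality. Keeping the factor 4 under regularization is what prevents
any loss in the log-Sobolev constant. -/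
theorem sq_deriv_regSq_le {δ : ℝ} (hδ : 0 < δ) (y : ℝ) : (2 * y / (1 + δ * y ^ 2) ^ 2) ^ 2 ≤ 4 * regSq δ y := by
  have h1 : 1 ≤ 1 + δ * y ^ 2 := le_add_of_nonneg_right (by positivity)
  have h2 : (2 * y / (1 + δ * y ^ 2) ^ 2) ^ 2 = 4 * (y ^ 2 / (1 + δ * y ^ 2) ^ 4) := by
    field_simp
    ring
  have h3 : y ^ 2 / (1 + δ * y ^ 2) ^ 4 ≤ y ^ 2 / (1 + δ * y ^ 2) := by
    gcongr
    exact le_self_pow₀ h1 (by norm_num)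
  rw [h2, regSq]
  linarith

theorem contDiff_regSq {δ : ℝ} (hδ : 0 < δ) : ContDiff ℝ 1 (regSq δ) := by
  unfold regSq
  refine contDiff_const.add ((contDiff_id.pow 2).div
    (contDiff_const.add (contDiff_const.mul (contDiff_id.pow 2))) fun y => ?_)
  positivity

/-- The function f = log (regSq δ (g x)) is bounded and satisfies ‖∇f‖² exp f ≤ 4 ‖∇g‖², so C / 2
becomes 2 C. -/
theorem HasPrekopaLeindler.entropy_regSq_le {ν : Measure E}
    [IsProbabilityMeasure ν] {C : ℝ≥0} (hν : HasPrekopaLeindler ν (QuadraticCost C))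
    {g : E → ℝ} (hg : ContDiff ℝ 1 g) (hgi : Integrable (fun x => ‖fderiv ℝ g x‖ ^ 2) ν)
    {δ : ℝ} (hδ : 0 < δ) :
    ∫ x, regSq δ (g x) * Real.log (regSq δ (g x)) ∂ν -
      (∫ x, regSq δ (g x) ∂ν) * Real.log (∫ x, regSq δ (g x) ∂ν) ≤
      2 * C * ∫ x, ‖fderiv ℝ g x‖ ^ 2 ∂ν := by
  have hpos : ∀ x, 0 < regSq δ (g x) := fun x => hδ.trans_le (le_regSq hδ _)
  set f : E → ℝ := fun x => Real.log (regSq δ (g x)) with hf_def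
  have hexp : ∀ x, Real.exp (f x) = regSq δ (g x) := fun x => Real.exp_log (hpos x)
  have hf : ContDiff ℝ 1 f := ((contDiff_regSq hδ).comp hg).log fun x => (hpos x).ne'
  have hdf : ∀ x, ‖fderiv ℝ f x‖ ^ 2 * regSq δ (g x) ≤ 4 * ‖fderiv ℝ g x‖ ^ 2 := by
    intro x
    have h1 : HasFDerivAt f _ x := ((hasDerivAt_regSq hδ (g x)).log (hpos x).ne').comp_hasFDerivAt x
      (hg.differentiable one_ne_zero x).hasFDerivAt
    rw [h1.fderiv, norm_smul, mul_pow, Real.norm_eq_abs, sq_abs, div_pow]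
    have h2 := sq_deriv_regSq_le hδ (g x)
    have h3 := hpos x
    calc _ = (2 * g x / (1 + δ * g x ^ 2) ^ 2) ^ 2 / regSq δ (g x) * ‖fderiv ℝ g x‖ ^ 2 := by
          field_simp
      _ ≤ 4 * ‖fderiv ℝ g x‖ ^ 2 := by
          gcongr
          rwa [div_le_iff₀ h3]
  have hf'm : Measurable fun x => ‖fderiv ℝ f x‖ :=
    (hf.continuous_fderiv one_ne_zero).norm.measurable
  have hfi : Integrable (fun x => ‖fderiv ℝ f x‖ ^ 2) ν := by
    refine (hgi.const_mul (4 / δ)).mono' (hf'm.pow_const 2).aestronglyMeasurable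
      (Eventually.of_forall fun x => ?_)
    rw [Real.norm_of_nonneg (sq_nonneg _), div_mul_eq_mul_div, le_div_iff₀ hδ]
    exact (mul_le_mul_of_nonneg_left (le_regSq hδ _) (sq_nonneg _)).trans (hdf x)
  have hfB : ∀ x, |f x| ≤ max |Real.log δ| |Real.log (δ + 1 / δ)| := fun x =>
    abs_le_max_abs_abs (Real.log_le_log hδ (le_regSq hδ _))
      (Real.log_le_log (hpos x) (regSq_le hδ _))
  have h := hν.entropy_exp_le_of_bounded hf hfB hfi
  simp only [hexp] at h
  simp only [mul_comm (regSq δ _)]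
  refine h.trans ?_
  have hC : (0 : ℝ) ≤ C := C.2
  calc C / 2 * ∫ x, ‖fderiv ℝ f x‖ ^ 2 * regSq δ (g x) ∂ν ≤
        C / 2 * ∫ x, 4 * ‖fderiv ℝ g x‖ ^ 2 ∂ν := by
        refine mul_le_mul_of_nonneg_left ?_ (by positivity)
        exact integral_mono_of_nonneg
          (Eventually.of_forall fun x => mul_nonneg (sq_nonneg _) (hpos x).le)
          (hgi.const_mul 4) (Eventually.of_forall hdf)
    _ = _ := by rw [integral_const_mul]; ring

/-- A measure with a Prékopa-Leindler inequality for a quadratic cost satisfies a log-Sobolev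
inequality. -/
theorem HasPrekopaLeindler.logSobolev {ν : Measure E}
    [IsProbabilityMeasure ν] {C : ℝ≥0} (hν : HasPrekopaLeindler ν (QuadraticCost C))
    {g : E → ℝ} (hg : ContDiff ℝ 1 g) (hg2 : Integrable (fun x => g x ^ 2) ν)
    (hgi : Integrable (fun x => ‖fderiv ℝ g x‖ ^ 2) ν) :
    Integrable (fun x => g x ^ 2 * Real.log (g x ^ 2)) ν ∧
      ∫ x, g x ^ 2 * Real.log (g x ^ 2) ∂ν -
        (∫ x, g x ^ 2 ∂ν) * Real.log (∫ x, g x ^ 2 ∂ν) ≤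
      2 * C * ∫ x, ‖fderiv ℝ g x‖ ^ 2 ∂ν := by
  let δ : ℕ → ℝ := fun n => 1 / ((n : ℝ) + 1)
  have hδ : ∀ n, 0 < δ n := fun n => Nat.one_div_pos_of_nat
  have hδ1 : ∀ n, δ n ≤ 1 := fun n =>
    div_le_one_of_le₀ (by linarith [n.cast_nonneg (α := ℝ)]) (by positivity)
  have hδ0 : Tendsto δ atTop (𝓝 0) := tendsto_one_div_add_atTop_nhds_zero_nat
  have hum : ∀ n, Measurable fun x => regSq (δ n) (g x) := fun n =>
    ((contDiff_regSq (hδ n)).continuous.comp hg.continuous).measurable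
  have hpos : ∀ n x, 0 < regSq (δ n) (g x) := fun n x => (hδ n).trans_le (le_regSq (hδ n) _)
  have hut : ∀ x, Tendsto (fun n => regSq (δ n) (g x)) atTop (𝓝 (g x ^ 2)) := by
    intro x
    have h1 : Tendsto (fun n => 1 + δ n * g x ^ 2) atTop (𝓝 (1 + 0 * g x ^ 2)) :=
      (hδ0.mul_const _).const_add 1
    have h2 := hδ0.add ((tendsto_const_nhds (x := g x ^ 2)).div h1 (by norm_num))
    simpa [regSq] using h2
  have hmean : Tendsto (fun n => ∫ x, regSq (δ n) (g x) ∂ν) atTop (𝓝 (∫ x, g x ^ 2 ∂ν)) := by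
    refine tendsto_integral_of_dominated_convergence (fun x => 1 + g x ^ 2)
      (fun n => (hum n).aestronglyMeasurable) ((integrable_const 1).add hg2)
      (fun n => Eventually.of_forall fun x => ?_) (Eventually.of_forall hut)
    rw [Real.norm_of_nonneg (hpos n x).le]
    exact (regSq_le_add_sq (hδ n) _).trans (by linarith [hδ1 n])
  -- The uniform lower bound permits Fatou, which yields integrability of the limit together with
  -- the inequality; only the means need dominated convergence.
  have hlow : ∀ y : ℝ, 0 < y → -1 ≤ y * Real.log y := fun y hy => by
    have h1 := mul_le_mul_of_nonneg_left (Real.one_sub_inv_le_log_of_pos hy) hy.le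
    rw [mul_sub, mul_inv_cancel₀ hy.ne'] at h1
    linarith
  have h := integrable_and_integral_le_of_tendsto (ν := ν)
    (F := fun n x => regSq (δ n) (g x) * Real.log (regSq (δ n) (g x)))
    (f := fun x => g x ^ 2 * Real.log (g x ^ 2))
    (a := fun n => 2 * C * ∫ x, ‖fderiv ℝ g x‖ ^ 2 ∂ν +
      (∫ x, regSq (δ n) (g x) ∂ν) * Real.log (∫ x, regSq (δ n) (g x) ∂ν))
    (fun n => (hum n).mul (hum n).log) (fun n => ?_) (fun n x => hlow _ (hpos n x))
    (fun x => (Real.continuous_mul_log.tendsto _).comp (hut x))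
    (fun n => by linarith [hν.entropy_regSq_le hg hgi (hδ n)])
    (((Real.continuous_mul_log.tendsto _).comp hmean).const_add _)
  · exact ⟨h.1, by linarith [h.2]⟩
  · refine Integrable.of_bound ((hum n).mul (hum n).log).aestronglyMeasurable
      ((δ n + 1 / δ n) * max |Real.log (δ n)| |Real.log (δ n + 1 / δ n)|)
      (Eventually.of_forall fun x => ?_)
    rw [norm_mul, Real.norm_of_nonneg (hpos n x).le, Real.norm_eq_abs]
    have := hδ n
    exact mul_le_mul (regSq_le (hδ n) _) (abs_le_max_abs_abs
      (Real.log_le_log (hδ n) (le_regSq (hδ n) _))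
      (Real.log_le_log (hpos n x) (regSq_le (hδ n) _))) (abs_nonneg _) (by positivity)

end

/-! ### Constants along the noisy proximal iteration. -/

theorem HasPrekopaLeindler.satisfiesLSI {ι : Type*} [Fintype ι]
    {ν : Measure (EuclideanSpace ℝ ι)} [IsProbabilityMeasure ν] {C : ℝ≥0}
    (hν : HasPrekopaLeindler ν (QuadraticCost C)) : SatisfiesLSI ν (C : ℝ≥0∞)⁻¹ := by
  refine ⟨inferInstance, by simp, fun g hg hg2 hgi => ?_⟩
  have hnorm : ∀ x, ‖gradient g x‖ = ‖fderiv ℝ g x‖ := fun x =>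
    LinearIsometryEquiv.norm_map _ _
  simp only [hnorm] at hgi ⊢
  -- Also valid for C = 0, where the constant is ∞ and both sides vanish.
  have h2C : (2 / (C : ℝ≥0∞)⁻¹).toReal = 2 * C := by simp [div_eq_mul_inv]
  rw [h2C]
  exact hν.logSobolev (hg.of_le (by exact_mod_cast le_top)) hg2 hgi

theorem HasPrekopaLeindler.noisyProxStep {ι : Type*} [Fintype ι] [DecidableEq ι] {η s : ℝ}
    (hη : 0 < η) (hs : 0 ≤ s) {f r : EuclideanSpace ℝ ι → ℝ} {LF LT : ℝ≥0}
    (hF : LipschitzWith LF (gradStep η f)) (hT : LipschitzWith LT (prox η r))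
    {μ : Measure (EuclideanSpace ℝ ι)} [IsProbabilityMeasure μ] {C : ℝ≥0}
    (hμ : HasPrekopaLeindler μ (QuadraticCost C)) :
    IsProbabilityMeasure (noisyProxStep η s f r μ) ∧
      HasPrekopaLeindler (noisyProxStep η s f r μ)
        (QuadraticCost (LT ^ 2 * (LF ^ 2 * C + (2 * η * s).toNNReal))) := by
  have hFμ : IsProbabilityMeasure (μ.map (gradStep η f)) :=
    Measure.isProbabilityMeasure_map hF.continuous.measurable.aemeasurable
  have hG := hasPrekopaLeindler_multivariateGaussian (ι := ι) (2 * η * s).toNNReal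
  rw [Real.coe_toNNReal _ (by positivity)] at hG
  exact ⟨Measure.isProbabilityMeasure_map hT.continuous.measurable.aemeasurable,
    ((hμ.map_lipschitz hF).conv hG).map_lipschitz hT⟩

/-- The weighted sum of noise levels that enters the log-Sobolev constant. -/
def noiseSum (a : ℕ → ℕ → ℝ≥0) (q : ℝ≥0) (m k j : ℕ) : ℝ≥0 :=
  (∑ k' ∈ Finset.range k, ∑ j' ∈ Finset.range m,
      a k' j' * q ^ (2 * ((k - k') * m - j' + j - 1)))
    + ∑ j' ∈ Finset.range j, a k j' * q ^ (2 * (j - j' - 1))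

/-- Each further iteration ages every earlier noise by a factor q² and adds a fresh one with
exponent 0. -/
theorem noiseSum_succ_right (a : ℕ → ℕ → ℝ≥0) (q : ℝ≥0) (m k j : ℕ) :
    noiseSum a q m k (j + 1) = q ^ 2 * noiseSum a q m k j + a k j := by
  unfold noiseSum
  rw [Finset.sum_range_succ, mul_add, Finset.mul_sum, Finset.mul_sum, ← add_assoc]
  congr 1
  · congr 1
    · refine Finset.sum_congr rfl fun k' hk' => ?_
      rw [Finset.mul_sum]
      refine Finset.sum_congr rfl fun j' hj' => ?_
      rw [Finset.mem_range] at hk' hj'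
      -- With j' < m this makes (k - k') m - j' at least 1, so the truncated subtractions are
      -- genuine.
      have h1 : m ≤ (k - k') * m := Nat.le_mul_of_pos_left m (by omega)
      rw [mul_left_comm, ← pow_add]
      congr 2
      omega
    · refine Finset.sum_congr rfl fun j' hj' => ?_
      rw [Finset.mem_range] at hj'
      rw [mul_left_comm, ← pow_add]
      congr 2
      omega
  · simp

/-- The current-epoch sum becomes the k' = k term of the double sum, which lets the induction cross
an epoch boundary. -/
theorem noiseSum_epoch_end (a : ℕ → ℕ → ℝ≥0) (q : ℝ≥0) (m k : ℕ) :
    noiseSum a q m k m = noiseSum a q m (k + 1) 0 := by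
  unfold noiseSum
  rw [Finset.sum_range_succ, Finset.sum_range_zero, add_zero]
  congr 1
  · refine Finset.sum_congr rfl fun k' hk' => Finset.sum_congr rfl fun j' hj' => ?_
    rw [Finset.mem_range] at hk' hj'
    have h1 : m ≤ (k - k') * m := Nat.le_mul_of_pos_left m (by omega)
    have h2 : (k + 1 - k') * m = (k - k') * m + m := by
      rw [show k + 1 - k' = (k - k') + 1 by omega, add_mul, one_mul]
    rw [h2]
    congr 2
    omega
  · refine Finset.sum_congr rfl fun j' hj' => ?_
    rw [show k + 1 - k = 1 by omega, one_mul, add_zero]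

theorem inv_coe_mul_noiseSum_eq_lsiConst (η : ℝ) (o : ℝ → ℕ → ℕ → ℝ) (LF LT : ℝ≥0) (m k j : ℕ) :
    ((2 * η.toNNReal * LT ^ 2 *
      noiseSum (fun k j => (o η k j).toNNReal) (LF * LT) m k j : ℝ≥0) : ℝ≥0∞)⁻¹ =
      lsiConst η o LF LT m k j := by
  rw [ENNReal.coe_mul, ENNReal.mul_inv (Or.inr ENNReal.coe_ne_top) (Or.inl ENNReal.coe_ne_top),
    lsiConst, one_div]
  unfold noiseSum
  push_cast
  rfl

theorem hasPrekopaLeindler_epochLaw {ι : Type*} [Fintype ι] [DecidableEq ι] {m : ℕ} {η : ℝ}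
    (hη : 0 < η) {o : ℝ → ℕ → ℕ → ℝ} (ho : ∀ k j, j < m → 0 ≤ o η k j)
    {f : ℕ → ℕ → EuclideanSpace ℝ ι → ℝ} {r : EuclideanSpace ℝ ι → ℝ} {LF LT : ℝ≥0}
    (hF : ∀ k j, j < m → LipschitzWith LF (gradStep η (f k j)))
    (hT : LipschitzWith LT (prox η r)) {k : ℕ} {μ : Measure (EuclideanSpace ℝ ι)}
    (hμp : IsProbabilityMeasure μ)
    (hμ : HasPrekopaLeindler μ (QuadraticCost (2 * η.toNNReal * LT ^ 2 *
      noiseSum (fun k j => (o η k j).toNNReal) (LF * LT) m k 0))) {j : ℕ} (hj : j ≤ m) :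
    IsProbabilityMeasure (epochLaw η o f r k μ j) ∧
      HasPrekopaLeindler (epochLaw η o f r k μ j) (QuadraticCost (2 * η.toNNReal * LT ^ 2 *
        noiseSum (fun k j => (o η k j).toNNReal) (LF * LT) m k j)) := by
  induction j with
  | zero => exact ⟨hμp, hμ⟩
  | succ j ih =>
    obtain ⟨hp, h⟩ := ih (by omega)
    have step := h.noisyProxStep hη (ho k j hj) (hF k j hj) hT
    refine ⟨step.1, ?_⟩
    change HasPrekopaLeindler (noisyProxStep _ _ _ _ _) _
    convert step.2 using 2
    -- With S the old noise sum: L_T² (L_F² · 2 η L_T² S + 2 η o) = 2 η L_T² ((L_F L_T)² S + o).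
    rw [noiseSum_succ_right, Real.toNNReal_mul (by positivity), Real.toNNReal_mul (by norm_num)]
    simp only [Real.toNNReal_ofNat]
    ring

theorem hasPrekopaLeindler_startLaw {ι : Type*} [Fintype ι] [DecidableEq ι] {m : ℕ} {η : ℝ}
    (hη : 0 < η) {o : ℝ → ℕ → ℕ → ℝ} (ho : ∀ k j, j < m → 0 ≤ o η k j)
    {f : ℕ → ℕ → EuclideanSpace ℝ ι → ℝ} {r : EuclideanSpace ℝ ι → ℝ} {LF LT : ℝ≥0}
    (hF : ∀ k j, j < m → LipschitzWith LF (gradStep η (f k j)))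
    (hT : LipschitzWith LT (prox η r)) (θ₀ : EuclideanSpace ℝ ι) (k : ℕ) :
    IsProbabilityMeasure (startLaw η o f r m θ₀ k) ∧
      HasPrekopaLeindler (startLaw η o f r m θ₀ k) (QuadraticCost (2 * η.toNNReal * LT ^ 2 *
        noiseSum (fun k j => (o η k j).toNNReal) (LF * LT) m k 0)) := by
  induction k with
  | zero => exact ⟨Measure.dirac.isProbabilityMeasure,
      hasPrekopaLeindler_dirac θ₀ (by simp [QuadraticCost])⟩
  | succ k ih =>
    rw [← noiseSum_epoch_end]
    exact hasPrekopaLeindler_epochLaw hη ho hF hT ih.1 ih.2 le_rfl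

theorem mainTheorem3 {ι : Type*} [Fintype ι] [DecidableEq ι]
    (n b : ℕ) (hb : 0 < b) (hbn : b ∣ n)
    (η : ℝ) (hη : 0 < η)
    (o : ℝ → ℕ → ℕ → ℝ) (ho : ∀ k j, j < n / b → 0 ≤ o η k j)
    (f : ℕ → ℕ → EuclideanSpace ℝ ι → ℝ)
    (hf : ∀ k j, j < n / b → Differentiable ℝ (f k j))
    (r : EuclideanSpace ℝ ι → ℝ) (hr : ConvexOn ℝ Set.univ r)
    (θ₀ : EuclideanSpace ℝ ι)
    (LF LT : ℝ≥0)
    (hF : ∀ k j, j < n / b → LipschitzWith LF (gradStep η (f k j)))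
    (hT : LipschitzWith LT (prox η r))
    (k j : ℕ) (hj : j ≤ n / b) :
    SatisfiesLSI (paramLaw η o f r (n / b) θ₀ k j) (lsiConst η o LF LT (n / b) k j) := by
  obtain ⟨hp, h⟩ := hasPrekopaLeindler_startLaw hη ho hF hT θ₀ k
  obtain ⟨hp', h'⟩ := hasPrekopaLeindler_epochLaw hη ho hF hT hp h hj
  rw [← inv_coe_mul_noiseSum_eq_lsiConst]
  exact h'.satisfiesLSI
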